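/- **Theorem (generators of $PU(2,1;\mathcal{O}_{11})$).** Let $\omega_{11}=\frac{1+i\sqrt{11}}{2}$ and let $\mathcal{O}_{11}=\mathbb{Z}[\omega_{11}]\subset\mathbb{C}$, the ring of integers of $\mathbb{Q}(\sqrt{-11})$. Let $U(2,1)$ be the group of invertible complex $3\times3$ matrices preserving the Hermitian form $\langle z,w\rangle=z_1\bar w_3+z_2\bar w_2+z_3\bar w_1$ on $\mathbb{C}^3$, let $PU(2,1)=U(2,1)/\{e^{i\theta}I:\theta\in\mathbb{R}\}$, and let $PU(2,1;\mathcal{O}_{11})$ be the image in $PU(2,1)$ of the group of those matrices in $U(2,1)$ all of whose entries lie in $\mathcal{O}_{11}$. Then $PU(2,1;\mathcal{O}_{11})$ is generated by the classes of the five matrices $$I_0=\begin{bmatrix}0&0&1\\0&-1&0\\1&0&0\end{bmatrix},\quad R^{(11)}_1=\begin{bmatrix}1&0&0\\0&-1&0\\0&0&1\end{bmatrix},\quad R^{(11)}_2=\begin{bmatrix}1&1&-\bar\omega_{11}\\0&-1&1\\0&0&1\end{bmatrix},$$ $$R^{(11)}_3=\begin{bmatrix}1&\bar\omega_{11}&-1-\bar\omega_{11}\\0&-1&\omega_{11}\\0&0&1\end{bmatrix},\quad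 T^{(11)}=\begin{bmatrix}1&0&i\sqrt{11}\\0&1&0\\0&0&1\end{bmatrix}.$$ Moreover, $R^{(11)}_2$ and $R^{(11)}_3$ are screw Heisenberg rotations, in the following sense. Identify $(\zeta,t)\in\mathbb{C}\times\mathbb{R}$ with the isotropic line spanned by $\left(\frac{-|\zeta|^2+it}{2},\,\zeta,\,1\right)^t$, and write $q_\infty$ for the line spanned by $(1,0,0)^t$. The Heisenberg translation by $(\tau,v)$ is $(\zeta,t)\mapsto(\zeta+\tau,\,t+v+2\,\mathrm{Im}(\tau\bar\zeta))$; it is vertical if $\tau=0$. The Heisenberg rotation through $\theta$ about $\zeta=\zeta_0$ is the conjugate of $(\zeta,t)\mapsto(e^{i\theta}\zeta,t)$ by the Heisenberg translation by $(\zeta_0,0)$. Then $R^{(11)}_2$ and $R^{(11)}_3$ fix $q_\infty$, and they act on $\mathbb{C}\times\mathbb{R}$ as the Heisenberg rotation through $\pi$ about $\zeta=\frac12$, respectively about $\zeta=\frac{1+i\sqrt{11}}{4}$, followed by the vertical translation by $\sqrt{11}$. -/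

import Mathlib

open Matrix Complex
open scoped ComplexConjugate

noncomputable section

namespace Picard

/-- The Hermitian form `⟨z, w⟩ = z₁ w̄₃ + z₂ w̄₂ + z₃ w̄₁` of signature `(2,1)` on `ℂ³`. -/
def hform (z w : Fin 3 → ℂ) : ℂ :=
  z 0 * conj (w 2) + z 1 * conj (w 1) + z 2 * conj (w 0)

/-- `U(2,1)`: the invertible complex `3 × 3` matrices preserving the Hermitian form. -/
def U21 : Subgroup (GL (Fin 3) ℂ) where
  carrier := {A | ∀ z w, hform ((A : Matrix (Fin 3) (Fin 3) ℂ) *ᵥ z)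
    ((A : Matrix (Fin 3) (Fin 3) ℂ) *ᵥ w) = hform z w}
  one_mem' := by intro z w; simp
  mul_mem' := by
    intro A B hA hB z w
    have h := hA ((B : Matrix (Fin 3) (Fin 3) ℂ) *ᵥ z) ((B : Matrix (Fin 3) (Fin 3) ℂ) *ᵥ w)
    rw [mulVec_mulVec, mulVec_mulVec] at h
    rw [Units.val_mul, h, hB]
  inv_mem' := by
    intro A hA z w
    have h := hA (((A⁻¹ : GL (Fin 3) ℂ) : Matrix (Fin 3) (Fin 3) ℂ) *ᵥ z)
      (((A⁻¹ : GL (Fin 3) ℂ) : Matrix (Fin 3) (Fin 3) ℂ) *ᵥ w)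
    rw [mulVec_mulVec, mulVec_mulVec, Units.mul_inv, one_mulVec, one_mulVec] at h
    exact h.symm

/-- The underlying matrix of an element of `U(2,1)`. -/
def mat (A : U21) : Matrix (Fin 3) (Fin 3) ℂ := ((A : GL (Fin 3) ℂ) : Matrix (Fin 3) (Fin 3) ℂ)

@[simp] lemma mat_one : mat 1 = 1 := rfl

@[simp] lemma mat_mul (A B : U21) : mat (A * B) = mat A * mat B := rfl

lemma mat_inv_mul (A : U21) : mat A⁻¹ * mat A = 1 := by
  rw [← mat_mul, inv_mul_cancel, mat_one]

lemma mat_mul_inv (A : U21) : mat A * mat A⁻¹ = 1 := by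
  rw [← mat_mul, mul_inv_cancel, mat_one]

lemma hform_mat (A : U21) (z w : Fin 3 → ℂ) : hform (mat A *ᵥ z) (mat A *ᵥ w) = hform z w :=
  A.2 z w

/-- The scalar matrices `e^{iθ} I`, a copy of `U(1)` in `U(2,1)`. -/
def U1 : Subgroup U21 where
  carrier := {A | ∃ θ : ℝ, mat A = Complex.exp (θ * I) • (1 : Matrix (Fin 3) (Fin 3) ℂ)}
  one_mem' := ⟨0, by simp⟩
  mul_mem' := by
    rintro A B ⟨a, ha⟩ ⟨b, hb⟩
    refine ⟨a + b, ?_⟩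
    rw [mat_mul, ha, hb]
    simp [smul_smul, ← Complex.exp_add, add_mul]
    ring_nf
  inv_mem' := by
    rintro A ⟨a, ha⟩
    refine ⟨-a, ?_⟩
    have h := mat_inv_mul A
    rw [ha, mul_smul_comm, mul_one] at h
    rw [← h, smul_smul, ← Complex.exp_add]
    simp

instance : U1.Normal where
  conj_mem := by
    rintro A ⟨a, ha⟩ B
    refine ⟨a, ?_⟩
    rw [mat_mul, mat_mul, ha, mul_smul_comm, mul_one, smul_mul_assoc, mat_mul_inv]

/-- `PU(2,1) = U(2,1) / U(1)`. -/
abbrev PU21 : Type := U21 ⧸ U1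

/-- `ω₁₁ = (1 + i√11) / 2`. -/
def ω : ℂ := (1 + I * (√11 : ℝ)) / 2

/-- `O₁₁ = ℤ[ω₁₁]`, as a subring of `ℂ`. -/
def O11 : Subring ℂ := (Algebra.adjoin ℤ {ω}).toSubring

lemma conj_ω : conj ω = 1 - ω := by
  simp only [ω, map_div₀, map_add, map_mul, map_one, conj_I, conj_ofReal, map_ofNat]
  ring

lemma ω_mul_conj : ω * conj ω = 3 := by
  have h : ((√11 : ℝ) : ℂ) ^ 2 = 11 := by
    rw [← ofReal_pow, Real.sq_sqrt (by norm_num)]; norm_num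
  simp only [ω, map_div₀, map_add, map_mul, map_one, conj_I, conj_ofReal, map_ofNat]
  linear_combination (1 / 4 : ℂ) * h - (1 / 4 : ℂ) * ((√11 : ℝ) : ℂ) ^ 2 * I_sq

lemma conj_mem_O11 {x : ℂ} (hx : x ∈ O11) : conj x ∈ O11 := by
  have hx' : x ∈ Algebra.adjoin ℤ {ω} := hx
  change conj x ∈ Algebra.adjoin ℤ {ω}
  induction hx' using Algebra.adjoin_induction with
  | mem y hy =>
    rw [Set.mem_singleton_iff.1 hy, conj_ω]
    exact sub_mem (one_mem _) (Algebra.subset_adjoin rfl)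
  | algebraMap n => simp
  | add a b ha hb iha ihb => rw [map_add]; exact add_mem (iha ha) (ihb hb)
  | mul a b ha hb iha ihb => rw [map_mul]; exact mul_mem (iha ha) (ihb hb)

lemma mat_inv_apply (A : U21) (i j : Fin 3) : mat A⁻¹ i j = conj (mat A (Fin.rev j) (Fin.rev i)) := by
  have h := hform_mat A (mat A⁻¹ *ᵥ Pi.single j 1) (Pi.single (Fin.rev i) 1)
  rw [mulVec_mulVec, mat_mul_inv, one_mulVec] at h
  have e1 : ∀ (z : Fin 3 → ℂ), hform z (Pi.single (Fin.rev i) 1) = z i := by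
    intro z; fin_cases i <;> simp [hform, Fin.rev]
  have e2 : ∀ (w : Fin 3 → ℂ), hform (Pi.single j 1) w = conj (w (Fin.rev j)) := by
    intro w; fin_cases j <;> simp [hform, Fin.rev]
  rw [e1, e2] at h
  simpa using h.symm

/-- `U(2,1; O₁₁)`: the elements of `U(2,1)` all of whose matrix entries lie in `O₁₁`. -/
def U21O11 : Subgroup U21 where
  carrier := {A | ∀ i j, mat A i j ∈ O11}
  one_mem' := by
    intro i j
    rw [mat_one, Matrix.one_apply]
    split_ifs
    · exact one_mem _
    · exact zero_mem _
  mul_mem' := by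
    intro A B hA hB i j
    rw [mat_mul, Matrix.mul_apply]
    exact sum_mem fun k _ => mul_mem (hA i k) (hB k j)
  inv_mem' := by
    intro A hA i j
    rw [mat_inv_apply]
    exact conj_mem_O11 (hA _ _)

/-- The Picard modular group `PU(2,1; O₁₁)`: the image of `U(2,1; O₁₁)` in `PU(2,1)`. -/
def PU21O11 : Subgroup PU21 := U21O11.map (QuotientGroup.mk' U1)

/-- The class in `PU(2,1)` of a form-preserving matrix of nonzero determinant. -/
def toPU (M : Matrix (Fin 3) (Fin 3) ℂ) (hdet : M.det ≠ 0)
    (hM : ∀ z w, hform (M *ᵥ z) (M *ᵥ w) = hform z w) : PU21 :=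
  QuotientGroup.mk' U1 ⟨Matrix.GeneralLinearGroup.mkOfDetNeZero M hdet, hM⟩

/-- The involution `I₀`. -/
def I₀ : PU21 := toPU !![0, 0, 1; 0, -1, 0; 1, 0, 0]
  (by simp [Matrix.det_fin_three])
  (by
    intro z w
    simp [hform, mulVec, dotProduct, Fin.sum_univ_three]
    ring)

/-- The rotation `R₁`. -/
def R₁ : PU21 := toPU !![1, 0, 0; 0, -1, 0; 0, 0, 1]
  (by simp [Matrix.det_fin_three])
  (by
    intro z w
    simp [hform, mulVec, dotProduct, Fin.sum_univ_three])

/-- The transformation `R₂`. -/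
def R₂ : PU21 := toPU !![1, 1, -conj ω; 0, -1, 1; 0, 0, 1]
  (by simp [Matrix.det_fin_three])
  (by
    intro z w
    simp [hform, mulVec, dotProduct, Fin.sum_univ_three, conj_ω]
    ring)

/-- The transformation `R₃`. -/
def R₃ : PU21 := toPU !![1, conj ω, -1 - conj ω; 0, -1, ω; 0, 0, 1]
  (by simp [Matrix.det_fin_three])
  (by
    intro z w
    have h := ω_mul_conj
    simp [hform, mulVec, dotProduct, Fin.sum_univ_three, conj_ω] at h ⊢
    linear_combination (z 2 * conj (w 2)) * h)

/-- The vertical translation `T`. -/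
def T : PU21 := toPU !![1, 0, I * (√11 : ℝ); 0, 1, 0; 0, 0, 1]
  (by simp [Matrix.det_fin_three])
  (by
    intro z w
    simp [hform, mulVec, dotProduct, Fin.sum_univ_three]
    ring)

/-- Left translation of the Heisenberg group `ℂ × ℝ` by `p = (τ, v)`:
`(ζ, t) ↦ (ζ + τ, t + v + 2 Im (τ ζ̄))`. -/
def heisTranslation (p q : ℂ × ℝ) : ℂ × ℝ :=
  (q.1 + p.1, q.2 + p.2 + 2 * (p.1 * conj q.1).im)

/-- The Heisenberg rotation `(ζ, t) ↦ (e^{iθ} ζ, t)` about the origin. -/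
def heisRotation (θ : ℝ) (q : ℂ × ℝ) : ℂ × ℝ := (Complex.exp (θ * I) * q.1, q.2)

/-- The Heisenberg rotation through `θ` about `ζ = ζ₀`: the conjugate of the rotation about the
origin by the Heisenberg translation by `(ζ₀, 0)`. (Conjugating by `(ζ₀, v)` gives the same map.) -/
def heisRotationAbout (ζ₀ : ℂ) (θ : ℝ) : ℂ × ℝ → ℂ × ℝ :=
  heisTranslation (ζ₀, 0) ∘ heisRotation θ ∘ heisTranslation (-ζ₀, 0)

/-- The standard lift of the boundary point with Heisenberg coordinates `(ζ, t)`. -/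
def heisLift (q : ℂ × ℝ) : Fin 3 → ℂ :=
  ![(-((‖q.1‖ ^ 2 : ℝ) : ℂ) + I * (q.2 : ℂ)) / 2, q.1, 1]

/-- The standard lift of the boundary point `q_∞`. -/
def qInf : Fin 3 → ℂ := ![1, 0, 0]

/-- `g ∈ PU(2,1)` fixes `q_∞` and acts as `f` on the rest of the boundary of the Siegel domain,
identified with the Heisenberg group. -/
def ActsOnHeisenbergAs (g : PU21) (f : ℂ × ℝ → ℂ × ℝ) : Prop :=
  ∀ A : U21, QuotientGroup.mk' U1 A = g →
    (∃ c : ℂ, c ≠ 0 ∧ mat A *ᵥ qInf = c • qInf) ∧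
    ∀ q : ℂ × ℝ, ∃ c : ℂ, c ≠ 0 ∧ mat A *ᵥ heisLift q = c • heisLift (f q)

/-- `g` is the screw Heisenberg rotation through `θ` about `ζ = ζ₀` with vertical part `s`: a
nontrivial Heisenberg rotation followed by a nontrivial vertical translation. -/
def IsScrewHeisenbergRotation (g : PU21) (ζ₀ : ℂ) (θ s : ℝ) : Prop :=
  Complex.exp (θ * I) ≠ 1 ∧ s ≠ 0 ∧
    ActsOnHeisenbergAs g (heisTranslation (0, s) ∘ heisRotationAbout ζ₀ θ)

end Picard

end

namespace Picard

/-! The generators have entries in `O11`; the content is that they suffice, and this is a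
Euclidean-style descent on the integer `normSq (mat A 2 0)`. If the lower left entry is nonzero, the
first column of `A` represents a finite boundary point. An integral Heisenberg translation moves
that point strictly inside the isometric sphere of `I₀`, and applying `I₀` then strictly lowers the
norm of the entry (`U21O11_le_lifts`). If the entry is zero, `A` fixes `q_∞`: since the only units
of `O11` are `±1`, up to `R₁` and the scalar `-1` it is an integral Heisenberg translation. All of
those come from `R₂R₁`, `R₃R₁` and `T` (`heis_mem_lifts`).

The descent needs the translates of the open isometric sphere to cover the whole Heisenberg group
(`covered`). Translations and symmetries reduce this to a box over `0 ≤ x ≤ 1/2`, `0 ≤ y ≤ 1/4`.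
Over each point of the box a few spheres cut out overlapping intervals of heights, which fill one
vertical period. Cutting the base into triangles and using convexity leaves only rational
inequalities at the vertices.

The screw rotations are a direct computation on standard lifts. -/

/-- The Heisenberg point `(x + i√11 y, √11 s)` is moved by some translation in
`U(2,1; O₁₁)`, namely one over `-(m + n ω)`, into the interior of the isometric sphere of `I₀`. -/
def Covered (x y s : ℝ) : Prop :=
  ∃ m n j : ℤ, Even (j - (m ^ 2 + m * n + 3 * n ^ 2)) ∧
    ((x - (m + n / 2)) ^ 2 + 11 * (y - n / 2) ^ 2) ^ 2
      + 11 * (s + n * x - (2 * m + n) * y + j) ^ 2 < 4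

/-! ### Symmetries of the covering condition -/

lemma covered_of_disc (m n j : ℤ) {x y s a px py : ℝ} (hj : Even (j - (m ^ 2 + m * n + 3 * n ^ 2)))
    (hpx : px = m + n / 2) (hpy : py = n / 2)
    (h : ((x - px) ^ 2 + 11 * (y - py) ^ 2) ^ 2 + 11 * a ^ 2 < 4)
    (h₁ : s + n * x - (2 * m + n) * y + j ≤ a) (h₂ : -a ≤ s + n * x - (2 * m + n) * y + j) :
    Covered x y s := by
  subst hpx hpy
  exact ⟨m, n, j, hj, by linarith [sq_le_sq' h₂ h₁]⟩

lemma Covered.of_translate (m n j : ℤ) {x y s : ℝ} (hj : Even (j - (m ^ 2 + m * n + 3 * n ^ 2)))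
    (h : Covered (x - (m + n / 2)) (y - n / 2) (s + n * x - (2 * m + n) * y + j)) :
    Covered x y s := by
  obtain ⟨m', n', j', hj', h⟩ := h
  -- The term `m' * n - n' * m` is the Heisenberg cocycle of the two translations.
  refine ⟨m' + m, n' + n, j' + j + (m' * n - n' * m), ?_, ?_⟩
  · have : j' + j + (m' * n - n' * m)
        - ((m' + m) ^ 2 + (m' + m) * (n' + n) + 3 * (n' + n) ^ 2)
        = (j - (m ^ 2 + m * n + 3 * n ^ 2)) + (j' - (m' ^ 2 + m' * n' + 3 * n' ^ 2))
          - 2 * (m * m' + n' * m + 3 * n' * n) := by ring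
    rw [this]
    exact (hj.add hj').sub (even_two_mul _)
  · convert h using 1
    push_cast
    ring

lemma Covered.of_neg {x y s : ℝ} (h : Covered (-x) (-y) s) : Covered x y s := by
  obtain ⟨m, n, j, hj, h⟩ := h
  refine ⟨-m, -n, j, by convert hj using 1; ring, ?_⟩
  convert h using 1
  push_cast
  ring

lemma Covered.of_conj {x y s : ℝ} (h : Covered x (-y) (-s)) : Covered x y s := by
  obtain ⟨m, n, j, hj, h⟩ := h
  refine ⟨m + n, -n, -j, ?_, ?_⟩
  · have : -j - ((m + n) ^ 2 + (m + n) * -n + 3 * (-n) ^ 2)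
        = j - (m ^ 2 + m * n + 3 * n ^ 2) - 2 * j := by ring
    rw [this]
    exact hj.sub (even_two_mul _)
  · convert h using 1
    push_cast
    ring

/-! ### Convexity and chains of intervals -/

/-- The quartic is a convex function of `(x, y, r)`, so interpolating the radius affinely over a
triangle reduces the bound to the vertices. The margin `3999 / 1000` at the vertices yields the
strict inequality. -/
lemma quartic_lt_of_triangle (P Q R : ℝ × ℝ) (px py r₁ r₂ r₃ x y : ℝ) {u v w : ℝ}
    (hu : 0 ≤ u) (hv : 0 ≤ v) (hw : 0 ≤ w) (huvw : u + v + w = 1)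
    (hx : x = u * P.1 + v * Q.1 + w * R.1) (hy : y = u * P.2 + v * Q.2 + w * R.2)
    (h₁ : ((P.1 - px) ^ 2 + 11 * (P.2 - py) ^ 2) ^ 2 + 11 * r₁ ^ 2 ≤ 3999 / 1000)
    (h₂ : ((Q.1 - px) ^ 2 + 11 * (Q.2 - py) ^ 2) ^ 2 + 11 * r₂ ^ 2 ≤ 3999 / 1000)
    (h₃ : ((R.1 - px) ^ 2 + 11 * (R.2 - py) ^ 2) ^ 2 + 11 * r₃ ^ 2 ≤ 3999 / 1000) :
    ((x - px) ^ 2 + 11 * (y - py) ^ 2) ^ 2 + 11 * (u * r₁ + v * r₂ + w * r₃) ^ 2 < 4 := by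
  have jensen : ∀ a b c : ℝ, (u * a + v * b + w * c) ^ 2 ≤ u * a ^ 2 + v * b ^ 2 + w * c ^ 2 := by
    intro a b c
    have e : u * a ^ 2 + v * b ^ 2 + w * c ^ 2 - (u * a + v * b + w * c) ^ 2
        = u * v * (a - b) ^ 2 + u * w * (a - c) ^ 2 + v * w * (b - c) ^ 2 := by
      obtain rfl : w = 1 - u - v := by linarith
      ring
    have : 0 ≤ u * v * (a - b) ^ 2 + u * w * (a - c) ^ 2 + v * w * (b - c) ^ 2 := by positivity
    linarith
  have ex : x - px = u * (P.1 - px) + v * (Q.1 - px) + w * (R.1 - px) := by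
    rw [hx]; linear_combination px * huvw
  have ey : y - py = u * (P.2 - py) + v * (Q.2 - py) + w * (R.2 - py) := by
    rw [hy]; linear_combination py * huvw
  have hq : (x - px) ^ 2 + 11 * (y - py) ^ 2 ≤
      u * ((P.1 - px) ^ 2 + 11 * (P.2 - py) ^ 2) + v * ((Q.1 - px) ^ 2 + 11 * (Q.2 - py) ^ 2)
        + w * ((R.1 - px) ^ 2 + 11 * (R.2 - py) ^ 2) := by
    rw [ex, ey]
    linarith [jensen (P.1 - px) (Q.1 - px) (R.1 - px), jensen (P.2 - py) (Q.2 - py) (R.2 - py)]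
  have hq2 := (pow_le_pow_left₀ (by positivity) hq 2).trans (jensen _ _ _)
  have hr := jensen r₁ r₂ r₃
  have k₁ := mul_le_mul_of_nonneg_left h₁ hu
  have k₂ := mul_le_mul_of_nonneg_left h₂ hv
  have k₃ := mul_le_mul_of_nonneg_left h₃ hw
  linarith

/-- Over `(x, y)` the sphere centred over `0` covers the heights `[-a, a]` and, one period down,
`[-2 - a, -2 + a]`; the one centred over `1` covers radius `b` about `2y - 1`. The gap hypotheses
make consecutive intervals meet, so they fill `[-2, 0]`. -/
lemma covered_of_two_discs {x y s a b : ℝ}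
    (h₀ : ((x - 0) ^ 2 + 11 * (y - 0) ^ 2) ^ 2 + 11 * a ^ 2 < 4)
    (h₁ : ((x - 1) ^ 2 + 11 * (y - 0) ^ 2) ^ 2 + 11 * b ^ 2 < 4)
    (ha : 0 ≤ a) (g₁ : 1 - 2 * y ≤ a + b) (g₂ : 1 + 2 * y ≤ b + a)
    (hs₁ : -2 ≤ s) (hs₂ : s ≤ 0) : Covered x y s := by
  by_cases c₁ : -a ≤ s
  · exact covered_of_disc 0 0 0 (by decide) (by norm_num) (by norm_num) h₀
      (by push_cast; linarith) (by push_cast; linarith)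
  by_cases c₂ : -b ≤ s - 2 * y + 1
  · exact covered_of_disc 1 0 1 (by decide) (by norm_num) (by norm_num) h₁
      (by push_cast; linarith) (by push_cast; linarith)
  exact covered_of_disc 0 0 2 (by decide) (by norm_num) (by norm_num) h₀
    (by push_cast; linarith) (by push_cast; linarith)

/-- The same chain with a further link over `-1`, at height `-2y - 1`. -/
lemma covered_of_three_left_discs {x y s a b c : ℝ}
    (h₀ : ((x - 0) ^ 2 + 11 * (y - 0) ^ 2) ^ 2 + 11 * a ^ 2 < 4)
    (h₁ : ((x - 1) ^ 2 + 11 * (y - 0) ^ 2) ^ 2 + 11 * b ^ 2 < 4)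
    (h₂ : ((x - (-1)) ^ 2 + 11 * (y - 0) ^ 2) ^ 2 + 11 * c ^ 2 < 4)
    (ha : 0 ≤ a) (g₁ : 1 - 2 * y ≤ a + b) (g₂ : 4 * y ≤ b + c) (g₃ : 1 - 2 * y ≤ c + a)
    (hs₁ : -2 ≤ s) (hs₂ : s ≤ 0) : Covered x y s := by
  by_cases c₁ : -a ≤ s
  · exact covered_of_disc 0 0 0 (by decide) (by norm_num) (by norm_num) h₀
      (by push_cast; linarith) (by push_cast; linarith)
  by_cases c₂ : -b ≤ s - 2 * y + 1
  · exact covered_of_disc 1 0 1 (by decide) (by norm_num) (by norm_num) h₁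
      (by push_cast; linarith) (by push_cast; linarith)
  by_cases c₃ : -c ≤ s + 2 * y + 1
  · exact covered_of_disc (-1) 0 1 (by decide) (by norm_num) (by norm_num) h₂
      (by push_cast; linarith) (by push_cast; linarith)
  exact covered_of_disc 0 0 2 (by decide) (by norm_num) (by norm_num) h₀
    (by push_cast; linarith) (by push_cast; linarith)

/-- Here the further link is over `ω`, at height `y - x - 1`. -/
lemma covered_of_three_right_discs {x y s a b c : ℝ}
    (h₀ : ((x - 0) ^ 2 + 11 * (y - 0) ^ 2) ^ 2 + 11 * a ^ 2 < 4)
    (h₁ : ((x - 1) ^ 2 + 11 * (y - 0) ^ 2) ^ 2 + 11 * b ^ 2 < 4)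
    (h₂ : ((x - (1 / 2)) ^ 2 + 11 * (y - (1 / 2)) ^ 2) ^ 2 + 11 * c ^ 2 < 4)
    (ha : 0 ≤ a) (g₁ : 1 - 2 * y ≤ a + b) (g₂ : x + y ≤ b + c) (g₃ : 1 - x + y ≤ c + a)
    (hs₁ : -2 ≤ s) (hs₂ : s ≤ 0) : Covered x y s := by
  by_cases c₁ : -a ≤ s
  · exact covered_of_disc 0 0 0 (by decide) (by norm_num) (by norm_num) h₀
      (by push_cast; linarith) (by push_cast; linarith)
  by_cases c₂ : -b ≤ s - 2 * y + 1
  · exact covered_of_disc 1 0 1 (by decide) (by norm_num) (by norm_num) h₁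
      (by push_cast; linarith) (by push_cast; linarith)
  by_cases c₃ : -c ≤ s + x - y + 1
  · exact covered_of_disc 0 1 1 (by decide) (by norm_num) (by norm_num) h₂
      (by push_cast; linarith) (by push_cast; linarith)
  exact covered_of_disc 0 0 2 (by decide) (by norm_num) (by norm_num) h₀
    (by push_cast; linarith) (by push_cast; linarith)

/-- The links are over `0`, `1`, `ω`, `ω - 1` and `0` again. -/
lemma covered_of_four_discs {x y s a b c d : ℝ}
    (h₀ : ((x - 0) ^ 2 + 11 * (y - 0) ^ 2) ^ 2 + 11 * a ^ 2 < 4)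
    (h₁ : ((x - 1) ^ 2 + 11 * (y - 0) ^ 2) ^ 2 + 11 * b ^ 2 < 4)
    (h₂ : ((x - (1 / 2)) ^ 2 + 11 * (y - (1 / 2)) ^ 2) ^ 2 + 11 * c ^ 2 < 4)
    (h₃ : ((x - (-1 / 2)) ^ 2 + 11 * (y - (1 / 2)) ^ 2) ^ 2 + 11 * d ^ 2 < 4)
    (ha : 0 ≤ a) (g₁ : 1 - 2 * y ≤ a + b) (g₂ : x + y ≤ b + c) (g₃ : 2 * y ≤ c + d)
    (g₄ : 1 - x - y ≤ d + a)
    (hs₁ : -2 ≤ s) (hs₂ : s ≤ 0) : Covered x y s := by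
  by_cases c₁ : -a ≤ s
  · exact covered_of_disc 0 0 0 (by decide) (by norm_num) (by norm_num) h₀
      (by push_cast; linarith) (by push_cast; linarith)
  by_cases c₂ : -b ≤ s - 2 * y + 1
  · exact covered_of_disc 1 0 1 (by decide) (by norm_num) (by norm_num) h₁
      (by push_cast; linarith) (by push_cast; linarith)
  by_cases c₃ : -c ≤ s + x - y + 1
  · exact covered_of_disc 0 1 1 (by decide) (by norm_num) (by norm_num) h₂
      (by push_cast; linarith) (by push_cast; linarith)
  by_cases c₄ : -d ≤ s + x + y + 1
  · exact covered_of_disc (-1) 1 1 (by decide) (by norm_num) (by norm_num) h₃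
      (by push_cast; linarith) (by push_cast; linarith)
  exact covered_of_disc 0 0 2 (by decide) (by norm_num) (by norm_num) h₀
    (by push_cast; linarith) (by push_cast; linarith)

/-! ### Triangulation of the box -/

lemma covered_of_mem_box_left {x y s : ℝ} (hx₁ : 0 ≤ x) (hx₃ : x ≤ 1 / 4) (hy₃ : 3 / 20 ≤ y)
    (hy₂ : y ≤ 1 / 4) (hs₁ : -2 ≤ s) (hs₂ : s ≤ 0) : Covered x y s := by
  -- The rectangle is cut along its diagonal from `(0, 3/20)` to `(1/4, 1/4)`.
  rcases le_total (10 * y) (4 * x + 3 / 2) with h | h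
  -- These are the barycentric coordinates of `(x, y)` in the triangle; the radii passed to `H`
  -- below are admissible rational radii at its three vertices.
  · obtain ⟨hu, hv, hw⟩ : 0 ≤ -4 * x + 1 ∧
        0 ≤ 4 * x - 10 * y + 3 / 2 ∧
        0 ≤ 10 * y - 3 / 2 := by
      refine ⟨?_, ?_, ?_⟩ <;> linarith
    have H := fun px py r₁ r₂ r₃ => quartic_lt_of_triangle (0, 3 / 20)
      (1 / 4, 3 / 20) (1 / 4, 1 / 4) px py r₁ r₂ r₃ x y hu hv hw (by ring) (by ring) (by ring)
    exact covered_of_four_discs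
      (H 0 0 (299 / 500) (119 / 200) (279 / 500)
        (by norm_num) (by norm_num) (by norm_num))
      (H 1 0 (471 / 1000) (551 / 1000) (47 / 100)
        (by norm_num) (by norm_num) (by norm_num))
      (H (1 / 2) (1 / 2) (181 / 500) (427 / 1000) (279 / 500)
        (by norm_num) (by norm_num) (by norm_num))
      (H (-1 / 2) (1 / 2) (181 / 500) (89 / 500) (47 / 100)
        (by norm_num) (by norm_num) (by norm_num))
      (by linarith) (by linarith) (by linarith) (by linarith) (by linarith) hs₁ hs₂
  · obtain ⟨hu, hv, hw⟩ : 0 ≤ -10 * y + 5 / 2 ∧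
        0 ≤ 4 * x ∧
        0 ≤ -4 * x + 10 * y - 3 / 2 := by
      refine ⟨?_, ?_, ?_⟩ <;> linarith
    have H := fun px py r₁ r₂ r₃ => quartic_lt_of_triangle (0, 3 / 20)
      (1 / 4, 1 / 4) (0, 1 / 4) px py r₁ r₂ r₃ x y hu hv hw (by ring) (by ring) (by ring)
    exact covered_of_four_discs
      (H 0 0 (299 / 500) (279 / 500) (283 / 500)
        (by norm_num) (by norm_num) (by norm_num))
      (H 1 0 (471 / 1000) (47 / 100) (323 / 1000)
        (by norm_num) (by norm_num) (by norm_num))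
      (H (1 / 2) (1 / 2) (181 / 500) (279 / 500) (133 / 250)
        (by norm_num) (by norm_num) (by norm_num))
      (H (-1 / 2) (1 / 2) (181 / 500) (47 / 100) (133 / 250)
        (by norm_num) (by norm_num) (by norm_num))
      (by linarith) (by linarith) (by linarith) (by linarith) (by linarith) hs₁ hs₂

/-- Outside the left rectangle the box is a fan of triangles with common apex `(8/25, 7/80)`. Each
case split is on the line from the apex through a vertex on the boundary. -/
lemma covered_of_mem_box_upper {x y s : ℝ} (hx₁ : 0 ≤ x) (hx₂ : x ≤ 1 / 2) (hy₁ : 0 ≤ y)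
    (hy₂ : y ≤ 1 / 4) (hE₁ : y ≤ 3 / 20 ∨ 1 / 4 ≤ x) (h4 : 7 / 80 ≤ y)
    (hs₁ : -2 ≤ s) (hs₂ : s ≤ 0) : Covered x y s := by
  rcases le_total (-13 / 80 * x + 9 / 50 * y + 29 / 800) 0 with h5 | h5
  · obtain ⟨hu, hv, hw⟩ : 0 ≤ 50 / 9 * x - 80 / 13 * y - 145 / 117 ∧
        0 ≤ 80 / 13 * y - 7 / 13 ∧
        0 ≤ -50 / 9 * x + 25 / 9 := by
      refine ⟨?_, ?_, ?_⟩ <;> linarith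
    have H := fun px py r₁ r₂ r₃ => quartic_lt_of_triangle (1 / 2, 7 / 80)
      (1 / 2, 1 / 4) (8 / 25, 7 / 80) px py r₁ r₂ r₃ x y hu hv hw (by ring) (by ring) (by ring)
    exact covered_of_three_right_discs
      (H 0 0 (297 / 500) (133 / 250) (3 / 5)
        (by norm_num) (by norm_num) (by norm_num))
      (H 1 0 (297 / 500) (133 / 250) (579 / 1000)
        (by norm_num) (by norm_num) (by norm_num))
      (H (1 / 2) (1 / 2) (53 / 250) (283 / 500) (23 / 125)
        (by norm_num) (by norm_num) (by norm_num))
      (by linarith) (by linarith) (by linarith) (by linarith) hs₁ hs₂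
  · rcases le_total (-13 / 80 * x - 7 / 100 * y + 93 / 1600) 0 with h6 | h6
    · obtain ⟨hu, hv, hw⟩ : 0 ≤ 4 * x + 112 / 65 * y - 93 / 65 ∧
          0 ≤ -4 * x + 288 / 65 * y + 58 / 65 ∧
          0 ≤ -80 / 13 * y + 20 / 13 := by
        refine ⟨?_, ?_, ?_⟩ <;> linarith
      have H := fun px py r₁ r₂ r₃ => quartic_lt_of_triangle (1 / 2, 1 / 4)
        (1 / 4, 1 / 4) (8 / 25, 7 / 80) px py r₁ r₂ r₃ x y hu hv hw (by ring) (by ring) (by ring)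
      exact covered_of_three_right_discs
        (H 0 0 (133 / 250) (279 / 500) (3 / 5)
          (by norm_num) (by norm_num) (by norm_num))
        (H 1 0 (133 / 250) (47 / 100) (579 / 1000)
          (by norm_num) (by norm_num) (by norm_num))
        (H (1 / 2) (1 / 2) (283 / 500) (279 / 500) (23 / 125)
          (by norm_num) (by norm_num) (by norm_num))
        (by linarith) (by linarith) (by linarith) (by linarith) hs₁ hs₂
    · rcases le_total (-1 / 16 * x - 7 / 100 * y + 209 / 8000) 0 with h7 | h7
      · obtain ⟨hu, hv, hw⟩ : 0 ≤ 125 / 14 * x + 10 * y - 209 / 56 ∧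
            0 ≤ -325 / 14 * x - 10 * y + 465 / 56 ∧
            0 ≤ 100 / 7 * x - 25 / 7 := by
          -- The edge opposite the apex borders the excluded rectangle, so nonnegativity of the
          -- weights needs `hE₁`.
          refine ⟨?_, ?_, ?_⟩ <;> rcases hE₁ with h | h <;> linarith
        have H := fun px py r₁ r₂ r₃ => quartic_lt_of_triangle (1 / 4, 1 / 4)
          (1 / 4, 3 / 20) (8 / 25, 7 / 80) px py r₁ r₂ r₃ x y hu hv hw (by ring) (by ring) (by ring)
        exact covered_of_three_right_discs
          (H 0 0 (279 / 500) (119 / 200) (3 / 5)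
            (by norm_num) (by norm_num) (by norm_num))
          (H 1 0 (47 / 100) (551 / 1000) (579 / 1000)
            (by norm_num) (by norm_num) (by norm_num))
          (H (1 / 2) (1 / 2) (279 / 500) (427 / 1000) (23 / 125)
            (by norm_num) (by norm_num) (by norm_num))
          (by linarith) (by linarith) (by linarith) (by linarith) hs₁ hs₂
      · rcases le_total (-1 / 16 * x - 8 / 25 * y + 6 / 125) 0 with h8 | h8
        · obtain ⟨hu, hv, hw⟩ : 0 ≤ 4 * x + 512 / 25 * y - 384 / 125 ∧
              0 ≤ -4 * x - 112 / 25 * y + 209 / 125 ∧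
              0 ≤ -16 * y + 12 / 5 := by
            refine ⟨?_, ?_, ?_⟩ <;> rcases hE₁ with h | h <;> linarith
          have H := fun px py r₁ r₂ r₃ => quartic_lt_of_triangle (1 / 4, 3 / 20)
            (0, 3 / 20) (8 / 25, 7 / 80) px py r₁ r₂ r₃ x y hu hv hw (by ring) (by ring) (by ring)
          exact covered_of_three_left_discs
            (H 0 0 (119 / 200) (299 / 500) (3 / 5)
              (by norm_num) (by norm_num) (by norm_num))
            (H 1 0 (551 / 1000) (471 / 1000) (579 / 1000)
              (by norm_num) (by norm_num) (by norm_num))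
            (H (-1) 0 (32 / 125) (471 / 1000) (49 / 200)
              (by norm_num) (by norm_num) (by norm_num))
            (by linarith) (by linarith) (by linarith) (by linarith) hs₁ hs₂
        · obtain ⟨hu, hv, hw⟩ : 0 ≤ -75 / 64 * x + 10 * y - 1 / 2 ∧
              0 ≤ -125 / 64 * x - 10 * y + 3 / 2 ∧
              0 ≤ 25 / 8 * x := by
            refine ⟨?_, ?_, ?_⟩ <;> linarith
          have H := fun px py r₁ r₂ r₃ => quartic_lt_of_triangle (0, 3 / 20)
            (0, 1 / 20) (8 / 25, 7 / 80) px py r₁ r₂ r₃ x y hu hv hw (by ring) (by ring) (by ring)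
          exact covered_of_three_left_discs
            (H 0 0 (299 / 500) (301 / 500) (3 / 5)
              (by norm_num) (by norm_num) (by norm_num))
            (H 1 0 (471 / 1000) (517 / 1000) (579 / 1000)
              (by norm_num) (by norm_num) (by norm_num))
            (H (-1) 0 (471 / 1000) (517 / 1000) (49 / 200)
              (by norm_num) (by norm_num) (by norm_num))
            (by linarith) (by linarith) (by linarith) (by linarith) hs₁ hs₂

lemma covered_of_mem_box_lower {x y s : ℝ} (hx₁ : 0 ≤ x) (hx₂ : x ≤ 1 / 2) (hy₁ : 0 ≤ y)
    (h4 : y ≤ 7 / 80) (hs₁ : -2 ≤ s) (hs₂ : s ≤ 0) : Covered x y s := by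
  rcases le_total (3 / 80 * x - 8 / 25 * y + 2 / 125) 0 with h1 | h1
  -- This triangle straddles `y = 7/80`, so it also serves as the last case of the upper half.
  · obtain ⟨hu, hv, hw⟩ : 0 ≤ -75 / 64 * x + 10 * y - 1 / 2 ∧
        0 ≤ -125 / 64 * x - 10 * y + 3 / 2 ∧
        0 ≤ 25 / 8 * x := by
      refine ⟨?_, ?_, ?_⟩ <;> linarith
    have H := fun px py r₁ r₂ r₃ => quartic_lt_of_triangle (0, 3 / 20)
      (0, 1 / 20) (8 / 25, 7 / 80) px py r₁ r₂ r₃ x y hu hv hw (by ring) (by ring) (by ring)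
    exact covered_of_three_left_discs
      (H 0 0 (299 / 500) (301 / 500) (3 / 5)
        (by norm_num) (by norm_num) (by norm_num))
      (H 1 0 (471 / 1000) (517 / 1000) (579 / 1000)
        (by norm_num) (by norm_num) (by norm_num))
      (H (-1) 0 (471 / 1000) (517 / 1000) (49 / 200)
        (by norm_num) (by norm_num) (by norm_num))
      (by linarith) (by linarith) (by linarith) (by linarith) hs₁ hs₂
  · rcases le_total (7 / 80 * x - 8 / 25 * y) 0 with h2 | h2
    · obtain ⟨hu, hv, hw⟩ : 0 ≤ -175 / 32 * x + 20 * y ∧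
          0 ≤ 75 / 32 * x - 20 * y + 1 ∧
          0 ≤ 25 / 8 * x := by
        refine ⟨?_, ?_, ?_⟩ <;> linarith
      have H := fun px py r₁ r₂ r₃ => quartic_lt_of_triangle (0, 1 / 20)
        (0, 0) (8 / 25, 7 / 80) px py r₁ r₂ r₃ x y hu hv hw (by ring) (by ring) (by ring)
      exact covered_of_two_discs
        (H 0 0 (301 / 500) (301 / 500) (3 / 5)
          (by norm_num) (by norm_num) (by norm_num))
        (H 1 0 (517 / 1000) (261 / 500) (579 / 1000)
          (by norm_num) (by norm_num) (by norm_num))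
        (by linarith) (by linarith) (by linarith) hs₁ hs₂
    · rcases le_total (7 / 80 * x + 9 / 50 * y - 7 / 160) 0 with h3 | h3
      · obtain ⟨hu, hv, hw⟩ : 0 ≤ -2 * x - 144 / 35 * y + 1 ∧
            0 ≤ 2 * x - 256 / 35 * y ∧
            0 ≤ 80 / 7 * y := by
          refine ⟨?_, ?_, ?_⟩ <;> linarith
        have H := fun px py r₁ r₂ r₃ => quartic_lt_of_triangle (0, 0)
          (1 / 2, 0) (8 / 25, 7 / 80) px py r₁ r₂ r₃ x y hu hv hw (by ring) (by ring) (by ring)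
        exact covered_of_two_discs
          (H 0 0 (301 / 500) (299 / 500) (3 / 5)
            (by norm_num) (by norm_num) (by norm_num))
          (H 1 0 (261 / 500) (299 / 500) (579 / 1000)
            (by norm_num) (by norm_num) (by norm_num))
          (by linarith) (by linarith) (by linarith) hs₁ hs₂
      · obtain ⟨hu, hv, hw⟩ : 0 ≤ -80 / 7 * y + 1 ∧
            0 ≤ 50 / 9 * x + 80 / 7 * y - 25 / 9 ∧
            0 ≤ -50 / 9 * x + 25 / 9 := by
          refine ⟨?_, ?_, ?_⟩ <;> linarith
        have H := fun px py r₁ r₂ r₃ => quartic_lt_of_triangle (1 / 2, 0)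
          (1 / 2, 7 / 80) (8 / 25, 7 / 80) px py r₁ r₂ r₃ x y hu hv hw (by ring) (by ring) (by ring)
        exact covered_of_two_discs
          (H 0 0 (299 / 500) (297 / 500) (3 / 5)
            (by norm_num) (by norm_num) (by norm_num))
          (H 1 0 (299 / 500) (297 / 500) (579 / 1000)
            (by norm_num) (by norm_num) (by norm_num))
          (by linarith) (by linarith) (by linarith) hs₁ hs₂

lemma covered_of_mem_box {x y s : ℝ} (hx₁ : 0 ≤ x) (hx₂ : x ≤ 1 / 2) (hy₁ : 0 ≤ y)
    (hy₂ : y ≤ 1 / 4) (hs₁ : -2 ≤ s) (hs₂ : s ≤ 0) : Covered x y s := by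
  rcases le_total y (7 / 80) with h4 | h4
  · exact covered_of_mem_box_lower hx₁ hx₂ hy₁ h4 hs₁ hs₂
  by_cases hE : x ≤ 1 / 4 ∧ 3 / 20 ≤ y
  · exact covered_of_mem_box_left hx₁ hE.1 hE.2 hy₂ hs₁ hs₂
  refine covered_of_mem_box_upper hx₁ hx₂ hy₁ hy₂ ?_ h4 hs₁ hs₂
  rcases le_total x (1 / 4) with h | h
  · exact Or.inl (le_of_not_ge fun h' => hE ⟨h, h'⟩)
  · exact Or.inr h

/-! ### Reduction to the box -/

lemma Covered.of_vertical_translate (j : ℤ) {x y s : ℝ} (h : Covered x y (s + 2 * j)) :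
    Covered x y s := by
  refine Covered.of_translate 0 0 (2 * j) (by simp) ?_
  convert h using 1
  · simp
  · simp
  · push_cast; ring

lemma covered_of_mem_rectangle {x y : ℝ} (s : ℝ) (hx₁ : 0 ≤ x) (hx₂ : x ≤ 1 / 2) (hy₁ : 0 ≤ y)
    (hy₂ : y ≤ 1 / 4) : Covered x y s := by
  refine Covered.of_vertical_translate (-⌈s / 2⌉) (covered_of_mem_box hx₁ hx₂ hy₁ hy₂ ?_ ?_)
  · push_cast; linarith [Int.ceil_lt_add_one (s / 2)]
  · push_cast; linarith [Int.le_ceil (s / 2)]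

/-- The isometric spheres centred at the translates of the origin under the Heisenberg
translations in `U(2,1; O₁₁)` cover the Heisenberg group. -/
theorem covered (x y s : ℝ) : Covered x y s := by
  have upper : ∀ {x y : ℝ} (s : ℝ), |x| ≤ 1 / 2 → 0 ≤ y → y ≤ 1 / 4 → Covered x y s := by
    intro x y s hx hy₁ hy₂
    rcases le_total 0 x with h | h
    · exact covered_of_mem_rectangle s h ((le_abs_self x).trans hx) hy₁ hy₂
    -- The composite is the reflection `(x, y, s) ↦ (-x, y, -s)`.
    · refine Covered.of_neg (Covered.of_conj ?_)
      rw [neg_neg]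
      exact covered_of_mem_rectangle _ (neg_nonneg.2 h) ((neg_le_abs x).trans hx) hy₁ hy₂
  have main : ∀ {x y : ℝ} (s : ℝ), |x| ≤ 1 / 2 → |y| ≤ 1 / 4 → Covered x y s := by
    intro x y s hx hy
    rcases le_total 0 y with h | h
    · exact upper s hx h ((le_abs_self y).trans hy)
    · exact Covered.of_neg (upper s (by rwa [abs_neg]) (neg_nonneg.2 h) ((neg_le_abs y).trans hy))
  -- Rounding in the basis `1, ω`: the imaginary part fixes `n`, then the real part fixes `m`.
  set n := round (2 * y)
  set m := round (x - n / 2)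
  refine Covered.of_translate m n (m ^ 2 + m * n + 3 * n ^ 2) (by simp) (main _ ?_ ?_)
  · have := abs_sub_round (x - n / 2)
    rwa [sub_sub, add_comm (n / 2 : ℝ)] at this
  · have := abs_sub_round (2 * y)
    rw [abs_le] at this ⊢
    constructor <;> linarith [this.1, this.2]

/-! ### The ring `O₁₁` -/

lemma ω_mem_O11 : ω ∈ O11 := Algebra.subset_adjoin rfl

lemma I_mul_sqrt_eleven : I * (√11 : ℝ) = 2 * ω - 1 := by
  simp only [ω]; ring

lemma ω_sq : ω ^ 2 = ω - 3 := by
  have := ω_mul_conj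
  rw [conj_ω] at this
  linear_combination -this

lemma int_mem_O11 (n : ℤ) : (n : ℂ) ∈ O11 := intCast_mem _ n

lemma mem_O11_iff {x : ℂ} : x ∈ O11 ↔ ∃ m n : ℤ, x = m + n * ω := by
  constructor
  · intro hx
    have hx' : x ∈ Algebra.adjoin ℤ {ω} := hx
    induction hx' using Algebra.adjoin_induction with
    | mem y hy => exact ⟨0, 1, by simp [Set.mem_singleton_iff.1 hy]⟩
    | algebraMap n => exact ⟨n, 0, by simp⟩
    | add a b ha hb iha ihb =>
      obtain ⟨m, n, rfl⟩ := iha ha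
      obtain ⟨m', n', rfl⟩ := ihb hb
      exact ⟨m + m', n + n', by push_cast; ring⟩
    | mul a b ha hb iha ihb =>
      obtain ⟨m, n, rfl⟩ := iha ha
      obtain ⟨m', n', rfl⟩ := ihb hb
      refine ⟨m * m' - 3 * n * n', m * n' + n * m' + n * n', ?_⟩
      push_cast
      linear_combination (n * n' : ℂ) * ω_sq
  · rintro ⟨m, n, rfl⟩
    exact add_mem (int_mem_O11 m) (mul_mem (int_mem_O11 n) ω_mem_O11)

lemma ω_re : ω.re = 1 / 2 := by simp [ω]

lemma ω_im : ω.im = √11 / 2 := by simp [ω]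

lemma normSq_int_add_int_mul_ω (m n : ℤ) :
    normSq (m + n * ω) = ((m ^ 2 + m * n + 3 * n ^ 2 : ℤ) : ℝ) := by
  have h := Real.sq_sqrt (show (0 : ℝ) ≤ 11 by norm_num)
  simp [normSq_apply, ω_re, ω_im]
  linear_combination (n ^ 2 / 4 : ℝ) * h

lemma exists_normSq_eq_nat {x : ℂ} (hx : x ∈ O11) : ∃ k : ℕ, normSq x = k := by
  obtain ⟨m, n, rfl⟩ := mem_O11_iff.1 hx
  refine ⟨(m ^ 2 + m * n + 3 * n ^ 2).toNat, ?_⟩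
  rw [normSq_int_add_int_mul_ω]
  have : (0 : ℤ) ≤ m ^ 2 + m * n + 3 * n ^ 2 := by nlinarith [sq_nonneg (2 * m + n), sq_nonneg n]
  exact_mod_cast (Int.toNat_of_nonneg this).symm

/-- Four times the norm is `(2m + n)² + 11n²`, which exceeds `4` unless `n = 0`. -/
lemma eq_one_or_neg_one_of_normSq {x : ℂ} (hx : x ∈ O11) (h : normSq x = 1) :
    x = 1 ∨ x = -1 := by
  obtain ⟨m, n, rfl⟩ := mem_O11_iff.1 hx
  rw [normSq_int_add_int_mul_ω] at h
  have h' : m ^ 2 + m * n + 3 * n ^ 2 = 1 := by exact_mod_cast h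
  have hn : n = 0 := by
    by_contra hn
    nlinarith [sq_nonneg (2 * m + n), Int.one_le_abs hn, sq_abs n]
  subst hn
  have : m = 1 ∨ m = -1 := by simpa using h'
  rcases this with rfl | rfl <;> simp

lemma normSq_eq_one_of_mul_conj {x y : ℂ} (hx : x ∈ O11) (hy : y ∈ O11) (h : x * conj y = 1) :
    normSq x = 1 ∧ normSq y = 1 := by
  obtain ⟨k, hk⟩ := exists_normSq_eq_nat hx
  obtain ⟨l, hl⟩ := exists_normSq_eq_nat hy
  have := congrArg normSq h
  rw [normSq_mul, normSq_conj, normSq_one, hk, hl] at this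
  have hkl : k * l = 1 := by exact_mod_cast this
  rw [hk, hl]
  obtain ⟨rfl, rfl⟩ := mul_eq_one.1 hkl
  simp

/-! ### Form-preserving matrices -/

/-- The element of `U(2,1)` given by a form-preserving matrix of nonzero determinant. -/
noncomputable def ofMat (M : Matrix (Fin 3) (Fin 3) ℂ) (hdet : M.det ≠ 0)
    (hM : ∀ z w, hform (M *ᵥ z) (M *ᵥ w) = hform z w) : U21 :=
  ⟨Matrix.GeneralLinearGroup.mkOfDetNeZero M hdet, hM⟩

@[simp] lemma mat_ofMat (M : Matrix (Fin 3) (Fin 3) ℂ) (hdet hM) : mat (ofMat M hdet hM) = M := rfl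

lemma mat_injective : Function.Injective mat := fun _ _ h => Subtype.ext (Units.ext h)

lemma hform_col (A : U21) (i j : Fin 3) :
    mat A 0 i * conj (mat A 2 j) + mat A 1 i * conj (mat A 1 j) + mat A 2 i * conj (mat A 0 j)
      = hform (Pi.single i 1) (Pi.single j 1) := by
  simpa [hform] using hform_mat A (Pi.single i 1) (Pi.single j 1)

/-- The Heisenberg translation `(ζ, t) ↦ (ζ + τ, …)` with upper right entry `μ`. -/
noncomputable def heis (τ μ : ℂ) (h : μ + conj μ + τ * conj τ = 0) : U21 :=
  ofMat !![1, -conj τ, μ; 0, 1, τ; 0, 0, 1] (by simp [Matrix.det_fin_three]) (by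
    intro z w
    simp [hform, mulVec, dotProduct, Fin.sum_univ_three]
    linear_combination (z 2 * conj (w 2)) * h)

@[simp] lemma mat_heis (τ μ : ℂ) (h) : mat (heis τ μ h) = !![1, -conj τ, μ; 0, 1, τ; 0, 0, 1] := rfl

lemma heis_relation_mul {τ μ τ' μ' : ℂ} (h : μ + conj μ + τ * conj τ = 0)
    (h' : μ' + conj μ' + τ' * conj τ' = 0) :
    (μ + μ' - conj τ * τ') + conj (μ + μ' - conj τ * τ') + (τ + τ') * conj (τ + τ') = 0 := by
  simp only [map_add, map_sub, map_mul, conj_conj]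
  linear_combination h + h'

lemma heis_mul {τ μ τ' μ' : ℂ} (h h') : heis τ μ h * heis τ' μ' h'
    = heis (τ + τ') (μ + μ' - conj τ * τ') (heis_relation_mul h h') := by
  apply mat_injective
  rw [mat_mul]
  ext i j
  fin_cases i <;> fin_cases j <;> simp [Matrix.mul_apply, Fin.sum_univ_three] <;> ring

/-- The subgroup of `U(2,1)` of the lifts of the elements of the group generated by the five
transformations. -/
noncomputable def lifts : Subgroup U21 :=
  (Subgroup.closure {I₀, R₁, R₂, R₃, T}).comap (QuotientGroup.mk' U1)

lemma mem_lifts {A : U21} : A ∈ lifts ↔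
    QuotientGroup.mk' U1 A ∈ Subgroup.closure {I₀, R₁, R₂, R₃, T} := Iff.rfl

lemma I₀_eq : ∃ A : U21, QuotientGroup.mk' U1 A = I₀ ∧
    mat A = !![0, 0, 1; 0, -1, 0; 1, 0, 0] := ⟨_, rfl, rfl⟩

lemma R₁_eq : ∃ A : U21, QuotientGroup.mk' U1 A = R₁ ∧
    mat A = !![1, 0, 0; 0, -1, 0; 0, 0, 1] := ⟨_, rfl, rfl⟩

lemma R₂_eq : ∃ A : U21, QuotientGroup.mk' U1 A = R₂ ∧
    mat A = !![1, 1, -conj ω; 0, -1, 1; 0, 0, 1] := ⟨_, rfl, rfl⟩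

lemma R₃_eq : ∃ A : U21, QuotientGroup.mk' U1 A = R₃ ∧
    mat A = !![1, conj ω, -1 - conj ω; 0, -1, ω; 0, 0, 1] := ⟨_, rfl, rfl⟩

lemma T_eq : ∃ A : U21, QuotientGroup.mk' U1 A = T ∧
    mat A = !![1, 0, I * (√11 : ℝ); 0, 1, 0; 0, 0, 1] := ⟨_, rfl, rfl⟩

lemma exists_I₀_mem_lifts : ∃ A ∈ lifts, mat A = !![0, 0, 1; 0, -1, 0; 1, 0, 0] := by
  obtain ⟨A, hA, hm⟩ := I₀_eq
  exact ⟨A, mem_lifts.2 (Subgroup.subset_closure (by simp [hA])), hm⟩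

lemma exists_R₁_mem_lifts : ∃ A ∈ lifts, mat A = !![1, 0, 0; 0, -1, 0; 0, 0, 1] := by
  obtain ⟨A, hA, hm⟩ := R₁_eq
  exact ⟨A, mem_lifts.2 (Subgroup.subset_closure (by simp [hA])), hm⟩

lemma U1_le_lifts : U1 ≤ lifts := by
  intro A hA
  rw [mem_lifts, QuotientGroup.mk'_apply, (QuotientGroup.eq_one_iff A).2 hA]
  exact one_mem _

/-! ### Heisenberg translations -/

lemma heis_zero_zero (h) : heis 0 0 h = 1 := by
  apply mat_injective
  ext i j
  fin_cases i <;> fin_cases j <;> simp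

lemma heis_inv {τ μ : ℂ} (h : μ + conj μ + τ * conj τ = 0) :
    (heis τ μ h)⁻¹ = heis (-τ) (conj μ) (by simpa [add_comm (conj μ)] using h) := by
  rw [inv_eq_iff_mul_eq_one, heis_mul]
  simp only [add_neg_cancel, mul_neg, sub_neg_eq_add]
  convert heis_zero_zero (by simp) using 2
  rw [← h]; ring

/-- The translation parts of the Heisenberg translations in the generated group. -/
def translationParts : AddSubgroup ℂ where
  carrier := {τ | τ ∈ O11 ∧ ∃ μ ∈ O11, ∃ h, heis τ μ h ∈ lifts}
  zero_mem' := ⟨zero_mem _, 0, zero_mem _, by simp, by rw [heis_zero_zero]; exact one_mem _⟩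
  add_mem' := by
    rintro τ τ' ⟨hτ, μ, hμ, h, hl⟩ ⟨hτ', μ', hμ', h', hl'⟩
    exact ⟨add_mem hτ hτ', _, sub_mem (add_mem hμ hμ') (mul_mem (conj_mem_O11 hτ) hτ'),
      heis_relation_mul h h', heis_mul h h' ▸ mul_mem hl hl'⟩
  neg_mem' := by
    rintro τ ⟨hτ, μ, hμ, h, hl⟩
    exact ⟨neg_mem hτ, conj μ, conj_mem_O11 hμ, _, heis_inv h ▸ inv_mem hl⟩

/-- The vertical Heisenberg translations in the generated group. -/
def verticalParts : AddSubgroup ℂ where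
  carrier := {μ | ∃ h, heis 0 μ h ∈ lifts}
  zero_mem' := ⟨by simp, by rw [heis_zero_zero]; exact one_mem _⟩
  add_mem' := by
    rintro μ μ' ⟨h, hl⟩ ⟨h', hl'⟩
    have := mul_mem hl hl'
    rw [heis_mul] at this
    simp only [add_zero, mul_zero, sub_zero] at this
    exact ⟨_, this⟩
  neg_mem' := by
    rintro μ ⟨h, hl⟩
    have e : conj μ = -μ := by
      rw [zero_mul, add_zero] at h
      linear_combination h
    have := inv_mem hl
    rw [heis_inv] at this
    simp only [neg_zero, e] at this
    exact ⟨_, this⟩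

/-- Right multiplication by `R₁` cancels the `-1` in the middle of `R₂`, leaving a pure translation;
`R₃` is treated likewise for `ω`. -/
lemma one_mem_translationParts : (1 : ℂ) ∈ translationParts := by
  obtain ⟨A, hA, hm⟩ := R₂_eq
  obtain ⟨B, hB, hm'⟩ := exists_R₁_mem_lifts
  have hA' : A ∈ lifts := mem_lifts.2 (Subgroup.subset_closure (by simp [hA]))
  refine ⟨one_mem _, -conj ω, neg_mem (conj_mem_O11 ω_mem_O11),
    by simp [conj_ω]; ring, ?_⟩
  convert mul_mem hA' hB
  apply mat_injective
  rw [mat_mul, hm, hm', mat_heis]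
  ext i j
  fin_cases i <;> fin_cases j <;> simp [Matrix.mul_apply, Fin.sum_univ_three]

lemma ω_mem_translationParts : ω ∈ translationParts := by
  obtain ⟨A, hA, hm⟩ := R₃_eq
  obtain ⟨B, hB, hm'⟩ := exists_R₁_mem_lifts
  have hA' : A ∈ lifts := mem_lifts.2 (Subgroup.subset_closure (by simp [hA]))
  refine ⟨ω_mem_O11, -1 - conj ω, sub_mem (neg_mem (one_mem _)) (conj_mem_O11 ω_mem_O11), ?_, ?_⟩
  · simp only [map_sub, map_neg, map_one, conj_conj, ω_mul_conj]
    rw [conj_ω]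
    ring
  convert mul_mem hA' hB
  apply mat_injective
  rw [mat_mul, hm, hm', mat_heis]
  ext i j
  fin_cases i <;> fin_cases j <;> simp [Matrix.mul_apply, Fin.sum_univ_three]

lemma mem_verticalParts : 2 * ω - 1 ∈ verticalParts := by
  obtain ⟨A, hA, hm⟩ := T_eq
  have hA' : A ∈ lifts := mem_lifts.2 (Subgroup.subset_closure (by simp [hA]))
  refine ⟨by simp only [map_sub, map_mul, map_ofNat, map_one, conj_ω]; ring, ?_⟩
  convert hA'
  apply mat_injective
  rw [hm, mat_heis, I_mul_sqrt_eleven, map_zero, neg_zero]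

/-- The translation part lies in the lattice spanned by `1` and `ω`. What remains is vertical, and
the purely imaginary elements of `O11` are the integer multiples of `2ω - 1 = i√11`, the entry of
`T`. -/
theorem heis_mem_lifts {τ μ : ℂ} (hτ : τ ∈ O11) (hμ : μ ∈ O11)
    (h : μ + conj μ + τ * conj τ = 0) : heis τ μ h ∈ lifts := by
  have hτ' : τ ∈ translationParts := by
    obtain ⟨m, n, rfl⟩ := mem_O11_iff.1 hτ
    have := add_mem (zsmul_mem one_mem_translationParts m) (zsmul_mem ω_mem_translationParts n)
    simpa using this
  obtain ⟨-, μ₀, hμ₀, h₀, hl₀⟩ := hτ'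
  have hv : μ - μ₀ ∈ verticalParts := by
    obtain ⟨m, n, hmn⟩ := mem_O11_iff.1 (sub_mem hμ hμ₀)
    have e : (μ - μ₀) + conj (μ - μ₀) = 0 := by
      rw [map_sub]; linear_combination h - h₀
    rw [hmn, map_add, map_mul, map_intCast, map_intCast, conj_ω] at e
    have e' : (2 * m + n : ℂ) = 0 := by linear_combination e
    have := zsmul_mem mem_verticalParts (-m)
    rw [zsmul_eq_mul] at this
    rw [hmn]
    convert this using 1
    push_cast
    linear_combination ω * e'
  obtain ⟨h₁, hl₁⟩ := hv
  have := mul_mem hl₁ hl₀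
  rw [heis_mul] at this
  simpa using this

/-! ### Reduction -/

/-- This is `covered` in matrix terms: the squared norm of the translated first coordinate is a
quarter of the quartic in `Covered`. -/
lemma exists_heis_normSq_lt_one {z ζ : ℂ} (h : z + conj z + ζ * conj ζ = 0) :
    ∃ τ ∈ O11, ∃ μ ∈ O11, μ + conj μ + τ * conj τ = 0 ∧
      normSq (z - conj τ * ζ + μ) < 1 := by
  have h11 := Real.sq_sqrt (show (0 : ℝ) ≤ 11 by norm_num)
  have h0 : √11 ≠ 0 := by positivity
  obtain ⟨y, hy⟩ : ∃ y, ζ.im = √11 * y := ⟨ζ.im / √11, by field_simp⟩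
  -- With `z.im = t / 2` this sets `s = -t / √11`; the sign makes the cross term of the translation
  -- agree with that in `Covered`.
  obtain ⟨s, hs⟩ : ∃ s, z.im = -(√11 / 2) * s := ⟨-(2 * z.im / √11), by field_simp⟩
  have hz : z.re = -(ζ.re ^ 2 + 11 * y ^ 2) / 2 := by
    have := congrArg re h
    simp [hy] at this
    linear_combination (1 / 2 : ℝ) * this - y ^ 2 / 2 * h11
  obtain ⟨m, n, j, ⟨k, hk⟩, hlt⟩ := covered ζ.re y s
  have hj : (j : ℝ) = m ^ 2 + m * n + 3 * n ^ 2 + 2 * k := by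
    have : j = m ^ 2 + m * n + 3 * n ^ 2 + 2 * k := by linarith
    rw [this]; push_cast; ring
  -- The real part of `μ` must be `-|τ|² / 2`. The parity condition, with quotient `k`, is what
  -- gives such a `μ` in `O11` with imaginary part `-j√11 / 2`.
  refine ⟨-(m + n * ω), neg_mem (mem_O11_iff.2 ⟨m, n, rfl⟩), k - j * ω,
    sub_mem (int_mem_O11 k) (mul_mem (int_mem_O11 j) ω_mem_O11), ?_, ?_⟩
  · have hjc : (j : ℂ) = m ^ 2 + m * n + 3 * n ^ 2 + 2 * k := by exact_mod_cast hj
    simp only [map_sub, map_add, map_mul, map_neg, map_intCast, conj_ω]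
    linear_combination -hjc - (n ^ 2 : ℂ) * ω_sq
  · have e₁ : (z - conj (-(m + n * ω)) * ζ + (k - j * ω)).re =
        -((ζ.re - (m + n / 2)) ^ 2 + 11 * (y - n / 2) ^ 2) / 2 := by
      simp [ω_re, ω_im, hz, hy]
      linear_combination (n * y / 2 : ℝ) * h11 - (1 / 2 : ℝ) * hj
    have e₂ : (z - conj (-(m + n * ω)) * ζ + (k - j * ω)).im =
        -(√11 / 2) * (s + n * ζ.re - (2 * m + n) * y + j) := by
      simp [ω_re, ω_im, hs, hy]
      ring
    rw [normSq_apply, e₁, e₂]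
    linear_combination (1 / 4 : ℝ) * hlt
      + ((s + n * ζ.re - (2 * m + n) * y + j) ^ 2 / 4) * h11

/-- Form preservation makes `A` upper triangular with unit diagonal and ties entry `(0, 1)` to entry
`(1, 2)`, so `A` is an integral Heisenberg translation. -/
lemma mem_lifts_of_unipotent {A : U21} (hA : A ∈ U21O11) (h0 : mat A 0 0 = 1)
    (h1 : mat A 1 1 = 1) (h2 : mat A 2 0 = 0) : A ∈ lifts := by
  have h00 := hform_col A 0 0
  have h02 := hform_col A 0 2
  have h01 := hform_col A 0 1
  have h12 := hform_col A 1 2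
  have h22 := hform_col A 2 2
  simp [hform, h2] at h00
  simp [hform, h0, h2, h00] at h02 h01
  have h02 : mat A 2 2 = 1 := by simpa using congrArg conj h02
  simp [hform, h1, h02, h01] at h12 h22
  have h : mat A 0 2 + conj (mat A 0 2) + mat A 1 2 * conj (mat A 1 2) = 0 := by
    linear_combination h22
  convert heis_mem_lifts (hA 1 2) (hA 0 2) h
  apply mat_injective
  rw [mat_heis]
  ext i j
  fin_cases i <;> fin_cases j <;> simp [h0, h1, h2, h00, h01, h02]
  linear_combination h12

lemma mem_lifts_of_apply_eq_one {A : U21} (hA : A ∈ U21O11) (h0 : mat A 0 0 = 1)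
    (h2 : mat A 2 0 = 0) : A ∈ lifts := by
  have h01 := hform_col A 0 1
  have h00 := hform_col A 0 0
  have h11 := hform_col A 1 1
  simp [hform, h2] at h00
  simp [hform, h0, h2, h00] at h01
  simp [hform, h01] at h11
  rcases eq_one_or_neg_one_of_normSq (hA 1 1)
    (normSq_eq_one_of_mul_conj (hA 1 1) (hA 1 1) h11).1 with h1 | h1
  · exact mem_lifts_of_unipotent hA h0 h1 h2
  obtain ⟨B, hB, hm⟩ := exists_R₁_mem_lifts
  have hBO : B ∈ U21O11 := by
    intro i j
    rw [hm]
    fin_cases i <;> fin_cases j <;> simp [zero_mem, one_mem]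
  refine (Subgroup.mul_mem_cancel_right _ hB).1 (mem_lifts_of_unipotent (mul_mem hA hBO) ?_ ?_ ?_)
  all_goals
    rw [mat_mul, hm]
    simp [Matrix.mul_apply, Fin.sum_univ_three, h0, h1, h2]

lemma mem_lifts_of_apply_eq_zero {A : U21} (hA : A ∈ U21O11) (h2 : mat A 2 0 = 0) :
    A ∈ lifts := by
  have h02 := hform_col A 0 2
  have h00 := hform_col A 0 0
  simp [hform, h2] at h00
  simp [hform, h2, h00] at h02
  rcases eq_one_or_neg_one_of_normSq (hA 0 0)
    (normSq_eq_one_of_mul_conj (hA 0 0) (hA 2 2) h02).1 with h0 | h0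
  · exact mem_lifts_of_apply_eq_one hA h0 h2
  obtain ⟨S, hm⟩ : ∃ S : U21, mat S = -1 :=
    ⟨ofMat (-1) (by simp [Matrix.det_neg]) (by intro z w; simp [neg_mulVec, hform]), rfl⟩
  -- The sign is harmless because `-1 = e^{iπ}` is trivial in `PU21`.
  have hS : S ∈ lifts := U1_le_lifts ⟨Real.pi, by rw [hm, exp_pi_mul_I, neg_one_smul]⟩
  have hSO : S ∈ U21O11 := by
    intro i j
    rw [hm]
    fin_cases i <;> fin_cases j <;> simp [zero_mem, one_mem]
  refine (Subgroup.mul_mem_cancel_right _ hS).1 (mem_lifts_of_apply_eq_one (mul_mem hA hSO) ?_ ?_)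
  all_goals
    rw [mat_mul, hm]
    simp [h0, h2]

theorem U21O11_le_lifts : U21O11 ≤ lifts := by
  have main : ∀ k : ℕ, ∀ A ∈ U21O11, normSq (mat A 2 0) = k → A ∈ lifts := by
    intro k
    induction k using Nat.strong_induction_on with
    | _ k ih =>
      intro A hA hk
      by_cases hc : mat A 2 0 = 0
      · exact mem_lifts_of_apply_eq_zero hA hc
      have h00 := hform_col A 0 0
      simp [hform] at h00
      -- The first column is isotropic; normalising its last coordinate to `1` gives the boundary
      -- point to be translated.
      obtain ⟨τ, hτ, μ, hμ, h, hlt⟩ := exists_heis_normSq_lt_one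
        (z := mat A 0 0 / mat A 2 0) (ζ := mat A 1 0 / mat A 2 0) (by
          have hc' : conj (mat A 2 0) ≠ 0 := by simpa using hc
          rw [map_div₀, map_div₀]
          field_simp
          linear_combination h00)
      obtain ⟨B, hB, hmB⟩ := exists_I₀_mem_lifts
      have hBO : B ∈ U21O11 := by
        intro i j
        rw [hmB]
        fin_cases i <;> fin_cases j <;> simp [zero_mem, one_mem]
      have hN : heis τ μ h ∈ U21O11 := by
        intro i j
        rw [mat_heis]
        fin_cases i <;> fin_cases j <;> simp [zero_mem, one_mem, conj_mem_O11, hτ, hμ]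
      have hM : B * heis τ μ h * A ∈ U21O11 := mul_mem (mul_mem hBO hN) hA
      -- `I₀` swaps the outer coordinates, so the new lower left entry is the first coordinate of
      -- the translated column.
      have e : mat (B * heis τ μ h * A) 2 0
          = (mat A 0 0 / mat A 2 0 - conj τ * (mat A 1 0 / mat A 2 0) + μ) * mat A 2 0 := by
        rw [mat_mul, mat_mul, hmB, mat_heis]
        simp [Matrix.mul_apply, Fin.sum_univ_three]
        field_simp
        ring
      obtain ⟨l, hl⟩ := exists_normSq_eq_nat (hM 2 0)
      have hlk : l < k := by
        have : (l : ℝ) < k := by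
          rw [← hl, ← hk, e, normSq_mul]
          exact mul_lt_of_lt_one_left (normSq_pos.2 hc) hlt
        exact_mod_cast this
      have := ih l hlk _ hM hl
      exact (Subgroup.mul_mem_cancel_left _ (mul_mem hB (heis_mem_lifts hτ hμ h))).1 this
  intro A hA
  obtain ⟨k, hk⟩ := exists_normSq_eq_nat (hA 2 0)
  exact main k A hA hk

theorem closure_eq : Subgroup.closure {I₀, R₁, R₂, R₃, T} = PU21O11 := by
  apply le_antisymm
  · rw [Subgroup.closure_le]
    have hω := ω_mem_O11
    have hω' := conj_mem_O11 hω
    have hT : I * (√11 : ℝ) ∈ O11 := by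
      rw [I_mul_sqrt_eleven, two_mul]
      exact sub_mem (add_mem hω hω) (one_mem _)
    have h3 : -1 - conj ω ∈ O11 := sub_mem (neg_mem (one_mem _)) hω'
    rintro g (rfl | rfl | rfl | rfl | rfl)
    · obtain ⟨A, hA, hm⟩ := I₀_eq
      refine ⟨A, fun i j => ?_, hA⟩
      rw [hm]
      fin_cases i <;> fin_cases j <;> simp [zero_mem, one_mem]
    · obtain ⟨A, hA, hm⟩ := R₁_eq
      refine ⟨A, fun i j => ?_, hA⟩
      rw [hm]
      fin_cases i <;> fin_cases j <;> simp [zero_mem, one_mem]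
    · obtain ⟨A, hA, hm⟩ := R₂_eq
      refine ⟨A, fun i j => ?_, hA⟩
      rw [hm]
      fin_cases i <;> fin_cases j <;> simp [zero_mem, one_mem, hω']
    · obtain ⟨A, hA, hm⟩ := R₃_eq
      refine ⟨A, fun i j => ?_, hA⟩
      rw [hm]
      fin_cases i <;> fin_cases j <;> simp [zero_mem, one_mem, hω, hω', h3]
    · obtain ⟨A, hA, hm⟩ := T_eq
      refine ⟨A, fun i j => ?_, hA⟩
      rw [hm]
      fin_cases i <;> fin_cases j <;> simp [zero_mem, one_mem, hT]
  · rw [PU21O11, Subgroup.map_le_iff_le_comap]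
    exact U21O11_le_lifts

/-! ### Screw Heisenberg rotations -/

/-- One lift suffices: any other differs by a scalar `e^{iθ}`, which serves as the constant `c`. -/
lemma actsOnHeisenbergAs_of_lift {g : PU21} {f : ℂ × ℝ → ℂ × ℝ} (A : U21)
    (hA : QuotientGroup.mk' U1 A = g) (h : mat A *ᵥ qInf = qInf)
    (h' : ∀ q, mat A *ᵥ heisLift q = heisLift (f q)) : ActsOnHeisenbergAs g f := by
  intro B hB
  obtain ⟨u, ⟨θ, hu⟩, rfl⟩ := (QuotientGroup.mk'_eq_mk' U1).1 (hA.trans hB.symm)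
  have hm : mat (A * u) = Complex.exp (θ * I) • mat A := by
    rw [mat_mul, hu, mul_smul_comm, mul_one]
  refine ⟨⟨_, exp_ne_zero (θ * I), ?_⟩, fun q => ⟨_, exp_ne_zero (θ * I), ?_⟩⟩
  · rw [hm, smul_mulVec, h]
  · rw [hm, smul_mulVec, h']

lemma heisRotationAbout_pi (ζ₀ : ℂ) (q : ℂ × ℝ) :
    heisRotationAbout ζ₀ Real.pi q = (2 * ζ₀ - q.1, q.2 - 4 * (ζ₀ * conj q.1).im) := by
  simp [heisRotationAbout, heisTranslation, heisRotation, exp_pi_mul_I]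
  constructor <;> ring

/-- This is the common shape of `R₂` (`ζ₀ = 1/2`) and `R₃` (`ζ₀ = ω/2`). The last row keeps the
third coordinate equal to `1`, so standard lifts go to standard lifts exactly. -/
lemma isScrewHeisenbergRotation_of_lift {g : PU21} (ζ₀ : ℂ) (A : U21)
    (hA : QuotientGroup.mk' U1 A = g) {μ : ℂ} (hμ : μ = -2 * (ζ₀ * conj ζ₀) + I * (√11 : ℝ) / 2)
    (hm : mat A = !![1, 2 * conj ζ₀, μ; 0, -1, 2 * ζ₀; 0, 0, 1]) :
    IsScrewHeisenbergRotation g ζ₀ Real.pi √11 := by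
  refine ⟨by rw [exp_pi_mul_I]; norm_num, by positivity, actsOnHeisenbergAs_of_lift A hA ?_ ?_⟩
  · rw [hm]
    ext i
    fin_cases i <;> simp [qInf, mulVec, dotProduct, Fin.sum_univ_three]
  · rintro ⟨ζ, t⟩
    rw [hm, Function.comp_apply, heisRotationAbout_pi]
    ext i
    fin_cases i
    · simp [heisLift, heisTranslation, mulVec, dotProduct, Fin.sum_univ_three, hμ]
      rw [← ofReal_pow, ← ofReal_pow, ← normSq_eq_norm_sq, ← normSq_eq_norm_sq]
      apply Complex.ext <;> simp [normSq_apply] <;> ring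
    · simp [heisLift, heisTranslation, mulVec, dotProduct, Fin.sum_univ_three]
      ring
    · simp [heisLift, heisTranslation, mulVec, dotProduct, Fin.sum_univ_three]

end Picard

theorem mainTheorem3 :
    Subgroup.closure {Picard.I₀, Picard.R₁, Picard.R₂, Picard.R₃, Picard.T} = Picard.PU21O11 ∧
    Picard.IsScrewHeisenbergRotation Picard.R₂ (1 / 2) Real.pi √11 ∧
    Picard.IsScrewHeisenbergRotation Picard.R₃ ((1 + Complex.I * (√11 : ℝ)) / 4) Real.pi √11 := by
  refine ⟨Picard.closure_eq, ?_, ?_⟩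
  · obtain ⟨A, hA, hm⟩ := Picard.R₂_eq
    refine Picard.isScrewHeisenbergRotation_of_lift (μ := -conj Picard.ω) _ A hA ?_ ?_
    · rw [Picard.conj_ω, Picard.I_mul_sqrt_eleven, map_div₀, map_ofNat, map_one]
      ring
    · rw [hm, map_div₀, map_ofNat, map_one]
      norm_num
  · obtain ⟨A, hA, hm⟩ := Picard.R₃_eq
    have e : (1 + Complex.I * (√11 : ℝ)) / 4 = Picard.ω / 2 := by rw [Picard.ω]; ring
    rw [e]
    refine Picard.isScrewHeisenbergRotation_of_lift (μ := -1 - conj Picard.ω) _ A hA ?_ ?_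
    · have := Picard.ω_mul_conj
      rw [map_div₀, map_ofNat, Picard.I_mul_sqrt_eleven]
      rw [Picard.conj_ω] at this ⊢
      linear_combination (1 / 2 : ℂ) * this
    · rw [hm, map_div₀, map_ofNat, mul_div_cancel₀ _ two_ne_zero, mul_div_cancel₀ _ two_ne_zero]
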